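/- Theorem 3.6 (nonzero c.e. degree, computable $r$). For $X\subseteq\mathbb N$ let $\underline\rho(X)=\liminf_{n\to\infty}|X\cap\{0,\dots,n-1\}|/n$ be its lower density. For $r\in[0,1]$, a set $A\subseteq\mathbb N$ is partially computable at density $r$ if there is a partial computable function $\varphi$ that agrees with the characteristic function of $A$ on its domain, with $\underline\rho(\operatorname{dom}\varphi)\ge r$; and $A$ is coarsely computable at density $r$ if there is a computable set $C$ with $\underline\rho(\{n : n\in A\Leftrightarrow n\in C\})\ge r$. Let $\alpha(A)$ and $\gamma(A)$ be the suprema of those $r\in[0,1]$ such that $A$ is partially computable at density $r$, respectively coarsely computable at density $r$. Let $\mathbf a$ be a nonzero c.e. Turing degree, that is, the Turing degree of a noncomputable c.e. set, and let $r\in(0,1]$ be a computable real. Then there is a c.e. set $A$ of degree $\mathbf a$ such that $\alpha(A)=\gamma(A)=r$ and $A$ is not coarsely computable at density $r$. -/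

import Mathlib

namespace CoarseComp

/-- The characteristic function of a set of natural numbers. -/
noncomputable def charFn (A : Set ℕ) : ℕ → ℕ := A.indicator (fun _ => 1)

/-- The density of `A` below `n`, that is `|A ∩ {0, …, n-1}| / n` (used for `n ≥ 1`). -/
noncomputable def densityBelow (A : Set ℕ) (n : ℕ) : ℝ :=
  ((A ∩ Set.Iio n).ncard : ℝ) / (n : ℝ)

/-- The lower (asymptotic) density of `A`. -/
noncomputable def lowerDensity (A : Set ℕ) : ℝ :=
  Filter.liminf (densityBelow A) Filter.atTop

/-- The set where `A` and `B` agree. -/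
def agreement (A B : Set ℕ) : Set ℕ := {n | n ∈ A ↔ n ∈ B}

/-- `A` is partially computable at density `r`: some partial computable function agrees with the
characteristic function of `A` wherever it is defined, and its domain has lower density at
least `r`. -/
def PartiallyComputableAt (A : Set ℕ) (r : ℝ) : Prop :=
  ∃ φ : ℕ →. ℕ, Partrec φ ∧ (∀ n, ∀ v ∈ φ n, v = charFn A n) ∧ r ≤ lowerDensity φ.Dom

/-- `A` is coarsely computable at density `r`: some computable set agrees with `A` on a set of
lower density at least `r`. -/
def CoarselyComputableAt (A : Set ℕ) (r : ℝ) : Prop :=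
  ∃ C : Set ℕ, ComputablePred (fun n => n ∈ C) ∧ r ≤ lowerDensity (agreement A C)

/-- The partial computability bound `α(A)`. -/
noncomputable def partialBound (A : Set ℕ) : ℝ :=
  sSup {r : ℝ | r ∈ Set.Icc (0 : ℝ) 1 ∧ PartiallyComputableAt A r}

/-- The coarse computability bound `γ(A)`. -/
noncomputable def coarseBound (A : Set ℕ) : ℝ :=
  sSup {r : ℝ | r ∈ Set.Icc (0 : ℝ) 1 ∧ CoarselyComputableAt A r}

/-- The Turing degree of a set of natural numbers. -/
noncomputable def degree (A : Set ℕ) : TuringDegree :=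
  toAntisymmetrization TuringReducible (fun n => Part.some (charFn A n))

/-- The degree `0`, that is the degree of the computable sets. -/
noncomputable def zeroDegree : TuringDegree := degree ∅

/-- A c.e. degree is the degree of a computably enumerable set. -/
def IsCEDegree (a : TuringDegree) : Prop :=
  ∃ B : Set ℕ, REPred (fun n => n ∈ B) ∧ degree B = a

/-- A real is computable if it is the limit of a computable sequence of rationals
`(-1) ^ s k * p k / q k` with error at most `2⁻ᵏ` at place `k`. -/
def IsComputableReal (x : ℝ) : Prop :=
  ∃ s p q : ℕ → ℕ, Computable s ∧ Computable p ∧ Computable q ∧ (∀ k, q k ≠ 0) ∧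
    ∀ k, |(-1 : ℝ) ^ s k * (p k : ℝ) / (q k : ℝ) - x| ≤ (1 / 2 : ℝ) ^ k

end CoarseComp

/-! Let `b` enumerate a noncomputable set `B` of the given degree. The set `A` (`diagSet`) codes `B`
on the squares, which have density zero. Off the squares it diagonalizes on the blocks `[n!²,
(n+1)!²)`. Each block dwarfs everything before it, so what happens on block `n` fixes the density at
`(n+1)!²`.

Block `Nat.pair e m` belongs to requirement `e`, which may put numbers of it into `A` only at the
stage where `m` first appears in `B`. This permitting gives `A ≤ B`. If a requirement converges on
almost all its blocks but succeeded only finitely often, then `B` would be computable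
(`exists_success_ge`). So the diagonalization succeeds on infinitely many blocks
(`exists_requirement`).

Requirement `e` never acts on the reserved set `D e`, an increasing sequence of computable sets of
densities below `r` approaching `r`. An opponent can therefore be right on a block only on `D e` and
the squares, which keeps its lower density strictly below `r` (`lowerDensity_agreement_diagSet_lt`,
`lowerDensity_dom_lt`). Conversely, only requirements `e < k` act on `D k`, and each one enumerates
a computable set (`computablePred_successSet_section`). Hence `A ∩ D k` is computable, and both
bounds equal `r`. -/

open Nat.Partrec (Code)

/-! ### Closure properties of computable predicates. -/

namespace ComputablePred

variable {α β : Type*} [Primcodable α] [Primcodable β]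

theorem comp {p : β → Prop} {f : α → β} (hp : ComputablePred p) (hf : Computable f) :
    ComputablePred fun a => p (f a) := by
  obtain ⟨g, hg, rfl⟩ := computable_iff.1 hp
  exact computable_iff.2 ⟨_, hg.comp hf, rfl⟩

theorem and {p q : α → Prop} (hp : ComputablePred p) (hq : ComputablePred q) :
    ComputablePred fun a => p a ∧ q a := by
  obtain ⟨f, hf, rfl⟩ := computable_iff.1 hp
  obtain ⟨g, hg, rfl⟩ := computable_iff.1 hq
  exact computable_iff.2 ⟨_, Primrec.and.to_comp.comp hf hg, by simp⟩

theorem or {p q : α → Prop} (hp : ComputablePred p) (hq : ComputablePred q) :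
    ComputablePred fun a => p a ∨ q a := by
  obtain ⟨f, hf, rfl⟩ := computable_iff.1 hp
  obtain ⟨g, hg, rfl⟩ := computable_iff.1 hq
  exact computable_iff.2 ⟨_, Primrec.or.to_comp.comp hf hg, by simp⟩

theorem const (p : Prop) : ComputablePred fun _ : α => p := by
  classical
  exact computable_iff.2 ⟨fun _ => decide p, Computable.const _, by simp⟩

theorem eq {f g : α → β} (hf : Computable f) (hg : Computable g) :
    ComputablePred fun a => f a = g a :=
  (PrimrecPred.computablePred (p := fun x : β × β => x.1 = x.2) Primrec.eq).comp (hf.pair hg)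

theorem le {f g : α → ℕ} (hf : Computable f) (hg : Computable g) :
    ComputablePred fun a => f a ≤ g a :=
  (PrimrecPred.computablePred (p := fun x : ℕ × ℕ => x.1 ≤ x.2) Primrec.nat_le).comp (hf.pair hg)

theorem lt {f g : α → ℕ} (hf : Computable f) (hg : Computable g) :
    ComputablePred fun a => f a < g a :=
  (PrimrecPred.computablePred (p := fun x : ℕ × ℕ => x.1 < x.2) Primrec.nat_lt).comp (hf.pair hg)

theorem exists_lt {R : α → ℕ → Prop} (hR : ComputablePred fun p : α × ℕ => R p.1 p.2)
    {f : α → ℕ} (hf : Computable f) : ComputablePred fun a => ∃ x < f a, R a x := by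
  obtain ⟨g, hg, hgR⟩ := computable_iff.1 hR
  have hgR' : ∀ a x, R a x ↔ g (a, x) = true := fun a x => iff_of_eq (congrFun hgR (a, x))
  have hstep : Computable₂ fun (a : α) (p : ℕ × Bool) => p.2 || g (a, p.1) :=
    (Primrec.or.to_comp.comp (Computable.snd.comp Computable.snd)
      (hg.comp (Computable.fst.pair (Computable.fst.comp Computable.snd))) :)
  refine computable_iff.2 ⟨_, Computable.nat_rec hf (Computable.const false) hstep, ?_⟩
  funext a
  refine propext ?_
  induction f a with
  | zero => simp
  | succ n ih =>
    rw [Nat.exists_lt_succ_right, ih, hgR']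
    simp

theorem forall_lt {R : α → ℕ → Prop} (hR : ComputablePred fun p : α × ℕ => R p.1 p.2)
    {f : α → ℕ} (hf : Computable f) : ComputablePred fun a => ∀ x < f a, R a x :=
  (exists_lt (R := fun a x => ¬ R a x) hR.not hf).not.of_eq fun a => by push Not; rfl

end ComputablePred

namespace CoarseComp

open Filter Topology
open scoped Nat

/-! ### Turing reductions, degrees and enumerations. -/

theorem charFn_of_mem {A : Set ℕ} {n : ℕ} (h : n ∈ A) : charFn A n = 1 := by simp [charFn, h]

theorem charFn_of_notMem {A : Set ℕ} {n : ℕ} (h : n ∉ A) : charFn A n = 0 := by simp [charFn, h]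

theorem computable_charFn {A : Set ℕ} (hA : ComputablePred (· ∈ A)) : Computable (charFn A) := by
  classical
  exact (Computable.cond hA.decide (Computable.const 1) (Computable.const 0)).of_eq fun n => by
    by_cases h : n ∈ A <;> simp [charFn, h]

/-- One query to `B` followed by a partial computable procedure is a Turing reduction to `B`. -/
theorem turingReducible_of_query {A B : Set ℕ} {q : ℕ → ℕ} (hq : Computable q)
    {G : ℕ × ℕ →. ℕ} (hG : Partrec G) (h : ∀ x, charFn A x ∈ G (charFn B (q x), x)) :
    TuringReducible (fun n => Part.some (charFn A n)) (fun n => Part.some (charFn B n)) := by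
  refine RecursiveIn.iff_nat.2 ?_
  set O : Set (ℕ →. ℕ) := {fun n => Part.some (charFn B n)}
  have hq' : Nat.RecursiveIn O fun n => Part.some (q n) :=
    (Partrec.nat_iff.1 hq).recursiveIn
  have hid : Nat.RecursiveIn O fun n => Part.some n :=
    (Partrec.nat_iff.1 Computable.id).recursiveIn
  have hB : Nat.RecursiveIn O fun n => Part.some (charFn B (q n)) :=
    (Nat.RecursiveIn.comp (.oracle _ (Set.mem_singleton _)) hq').of_eq fun n => by simp
  have hG' : Nat.RecursiveIn O fun n => G n.unpair :=
    (Partrec.nat_iff.1 (hG.comp Computable.unpair)).recursiveIn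
  refine (Nat.RecursiveIn.comp hG' (hB.pair hid)).of_eq fun x => ?_
  rw [Part.eq_some_iff]
  simpa [Seq.seq] using h x

theorem degree_eq_of_turingReducible {A B : Set ℕ}
    (h₁ : TuringReducible (fun n => Part.some (charFn A n)) (fun n => Part.some (charFn B n)))
    (h₂ : TuringReducible (fun n => Part.some (charFn B n)) (fun n => Part.some (charFn A n))) :
    degree A = degree B :=
  Quotient.sound ⟨h₁, h₂⟩

theorem degree_eq_zeroDegree {B : Set ℕ} (hB : ComputablePred (· ∈ B)) :
    degree B = zeroDegree := by
  apply degree_eq_of_turingReducible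
  · exact Partrec.turingReducible (computable_charFn hB)
  · refine Partrec.turingReducible (computable_charFn ?_)
    simpa using ComputablePred.const (α := ℕ) False

theorem exists_computable_range_eq {B : Set ℕ} (hB : REPred (· ∈ B)) (hne : B.Nonempty) :
    ∃ b : ℕ → ℕ, Computable b ∧ Set.range b = B := by
  obtain ⟨n₀, hn₀⟩ := hne
  obtain ⟨c, hc⟩ := Code.exists_code.1
    (Partrec.nat_iff.1 (hB.map (Computable.const 0).to₂ : Partrec _))
  have hdom : ∀ n, n ∈ B ↔ ∃ k, (Code.evaln k c n).isSome := by
    intro n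
    have h1 : n ∈ B ↔ (0 : ℕ) ∈ c.eval n := by rw [hc]; simp
    have h2 : ∀ v ∈ c.eval n, v = 0 := by rw [hc]; simp
    simp only [Option.isSome_iff_exists]
    refine h1.trans ⟨fun h => ?_, ?_⟩
    · obtain ⟨k, hk⟩ := Code.evaln_complete.1 h
      exact ⟨k, 0, hk⟩
    · rintro ⟨k, v, hv⟩
      have := Code.evaln_sound hv
      rwa [h2 v this] at this
  -- Stage `s` codes a pair of an input and a step bound; a failed search outputs `n₀`, which is
  -- already in `B`.
  refine ⟨fun s => cond (Code.evaln s.unpair.2 c s.unpair.1).isSome s.unpair.1 n₀, ?_, ?_⟩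
  · have h1 : Computable fun s : ℕ => s.unpair.1 := Computable.fst.comp Computable.unpair
    have h2 : Computable fun s : ℕ => s.unpair.2 := Computable.snd.comp Computable.unpair
    exact Computable.cond (Primrec.option_isSome.to_comp.comp (Code.primrec_evaln.to_comp.comp
      ((h2.pair (Computable.const c)).pair h1))) h1 (Computable.const n₀)
  · ext n
    constructor
    · rintro ⟨s, rfl⟩
      cases h : (Code.evaln s.unpair.2 c s.unpair.1).isSome
      · simpa [h] using hn₀
      · simpa [h] using (hdom _).2 ⟨_, h⟩
    · intro hn
      obtain ⟨k, hk⟩ := (hdom n).1 hn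
      exact ⟨Nat.pair n k, by simp [hk]⟩

/-- Membership in `A` is decided by a computable test at the first stage at which a computable
enumeration of `B` reaches a given number. -/
theorem turingReducible_of_firstStage {b : ℕ → ℕ} (hb : Computable b) {q : ℕ → ℕ}
    (hq : Computable q) {P : ℕ → ℕ → Prop} (hP : ComputablePred fun p : ℕ × ℕ => P p.1 p.2)
    {A : Set ℕ} (hA : ∀ x, x ∈ A ↔ ∃ s, (∀ t < s, b t ≠ q x) ∧ b s = q x ∧ P x s) :
    REPred (· ∈ A) ∧ TuringReducible (fun n => Part.some (charFn A n))
      (fun n => Part.some (charFn (Set.range b) n)) := by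
  classical
  have hfind : Partrec fun x => Nat.rfind fun s => Part.some (decide (b s = q x)) :=
    Partrec.rfind (ComputablePred.eq (α := ℕ × ℕ) (hb.comp Computable.snd)
      (hq.comp Computable.fst)).decide.partrec
  have hmem : ∀ x s, s ∈ (Nat.rfind fun s => Part.some (decide (b s = q x))) ↔
      b s = q x ∧ ∀ t < s, b t ≠ q x := by
    intro x s
    refine Nat.mem_rfind.trans (and_congr ?_ (forall₂_congr fun t _ => ?_)) <;>
      simp [Part.mem_some_iff]
  constructor
  · have hdec : Partrec₂ fun x s => (Part.assert (P x s) fun _ => Part.some ()) :=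
      (hP.to_re :)
    refine (hfind.bind hdec).dom_re.of_eq fun x => ?_
    rw [hA, Part.dom_iff_mem]
    simp only [Part.mem_bind_iff, hmem, Part.mem_assert_iff, Part.mem_some_iff]
    constructor
    · rintro ⟨-, s, ⟨h1, h2⟩, h3, -⟩
      exact ⟨s, h2, h1, h3⟩
    · rintro ⟨s, h2, h1, h3⟩
      exact ⟨(), s, ⟨h1, h2⟩, h3, trivial⟩
  · have hout : Computable₂ fun (p : ℕ × ℕ) s => cond (decide (P p.2 s)) 1 0 :=
      Computable.cond (α := (ℕ × ℕ) × ℕ)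
        (hP.decide.comp ((Computable.snd.comp Computable.fst).pair Computable.snd))
        (Computable.const 1) (Computable.const 0)
    -- The oracle's answer is `p.1`. The unbounded search is started only if that answer is
    -- positive, so it terminates.
    have hG : Partrec fun p : ℕ × ℕ => cond (decide (p.1 = 0)) (Part.some 0)
        ((Nat.rfind fun s => Part.some (decide (b s = q p.2))).map
          fun s => cond (decide (P p.2 s)) 1 0) :=
      Partrec.cond (ComputablePred.eq Computable.fst (Computable.const 0)).decide
        (Computable.const 0) ((hfind.comp Computable.snd).map hout)
    refine turingReducible_of_query hq hG fun x => ?_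
    by_cases hx : q x ∈ Set.range b
    · rw [charFn_of_mem hx]
      have hs : b (Nat.find hx) = q x := Nat.find_spec hx
      have hmin : ∀ t < Nat.find hx, b t ≠ q x := fun t ht => Nat.find_min hx ht
      simp only [one_ne_zero, decide_false, cond_false, Part.mem_map_iff, hmem]
      refine ⟨_, ⟨hs, hmin⟩, ?_⟩
      by_cases hPx : P x (Nat.find hx)
      · rw [charFn_of_mem ((hA x).2 ⟨_, hmin, hs, hPx⟩)]
        simp [hPx]
      · rw [charFn_of_notMem]
        · simp [hPx]
        · rw [hA]
          rintro ⟨s, h1, h2, h3⟩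
          have : s = Nat.find hx := le_antisymm
            (not_lt.1 fun h => h1 _ h hs) (not_lt.1 fun h => hmin _ h h2)
          exact hPx (this ▸ h3)
    · rw [charFn_of_notMem hx, charFn_of_notMem]
      · simp
      · rw [hA]
        rintro ⟨s, -, h2, -⟩
        exact hx ⟨s, h2⟩

/-! ### Tables, factorial blocks and their assignment to requirements. -/

/-- Tables of values of computable functions are computable. -/
theorem computable_table {α σ : Type*} [Primcodable α] [Primcodable σ] {f : α → ℕ → σ}
    (hf : Computable₂ f) {k : α → ℕ} (hk : Computable k) :
    Computable fun a => (List.range (k a)).map (f a) := by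
  have hstep : Computable₂ fun (a : α) (p : ℕ × List σ) => p.2 ++ [f a p.1] :=
    (Computable.list_concat.comp (Computable.snd.comp Computable.snd)
      (hf.comp Computable.fst (Computable.fst.comp Computable.snd)) :)
  refine (Computable.nat_rec hk (Computable.const []) hstep).of_eq fun a => ?_
  induction k a with
  | zero => rfl
  | succ n ih => simp [List.range_succ, ih]

theorem computable_factorial : Computable Nat.factorial := by
  have hstep : Computable₂ fun (_ : ℕ) (p : ℕ × ℕ) => (p.1 + 1) * p.2 :=
    Primrec.nat_mul.to_comp.comp (α := ℕ × ℕ × ℕ)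
      (Computable.succ.comp (Computable.fst.comp Computable.snd))
      (Computable.snd.comp Computable.snd)
  refine (Computable.nat_rec Computable.id (Computable.const 1) hstep).of_eq fun n => ?_
  induction n with
  | zero => rfl
  | succ n ih => exact congrArg ((n + 1) * ·) ih

theorem exists_lt_factorial_succ (j : ℕ) : ∃ n, j < (n + 1)! :=
  ⟨j, (Nat.self_le_factorial (j + 1))⟩

/-- The index `n` of the block `[n!, (n+1)!)` that contains `j`. -/
def blockIndex (j : ℕ) : ℕ := Nat.find (exists_lt_factorial_succ j)

theorem lt_factorial_blockIndex_succ (j : ℕ) : j < (blockIndex j + 1)! :=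
  Nat.find_spec (exists_lt_factorial_succ j)

theorem blockIndex_eq {j n : ℕ} (h₁ : n ! ≤ j) (h₂ : j < (n + 1)!) : blockIndex j = n := by
  refine le_antisymm (Nat.find_min' _ h₂) (not_lt.1 fun h => ?_)
  have := (lt_factorial_blockIndex_succ j).trans_le (Nat.factorial_le h)
  omega

theorem computable_blockIndex : Computable blockIndex :=
  Computable.find (P := fun j n => j < (n + 1)!) (ComputablePred.lt Computable.fst
    (computable_factorial.comp (Computable.succ.comp Computable.snd))) exists_lt_factorial_succ

/-- The block of the number `x`. -/
def block (x : ℕ) : ℕ := blockIndex x.sqrt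

/-- The requirement to which the block of `x` is assigned. -/
def requirement (x : ℕ) : ℕ := (block x).unpair.1

/-- The number whose enumeration permits `x` to be enumerated. -/
def permit (x : ℕ) : ℕ := (block x).unpair.2

theorem computable_block : Computable block := computable_blockIndex.comp Primrec.nat_sqrt.to_comp

theorem computable_requirement : Computable requirement :=
  Computable.fst.comp (Computable.unpair.comp computable_block)

theorem computable_permit : Computable permit :=
  Computable.snd.comp (Computable.unpair.comp computable_block)

/-! ### Permitted requirements and their successes. -/

/-- The value at `n` of the `e`-th partial computable function, if found within `s` steps. -/
def valueAt (e n s : ℕ) : Option ℕ := Code.evaln s (Denumerable.ofNat Code e) n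

theorem computable_valueAt {α : Type*} [Primcodable α] {e n s : α → ℕ} (he : Computable e)
    (hn : Computable n) (hs : Computable s) : Computable fun a => valueAt (e a) (n a) (s a) :=
  Code.primrec_evaln.to_comp.comp ((hs.pair ((Computable.ofNat Code).comp he)).pair hn)

theorem isSome_valueAt_mono {e n s t : ℕ} (hst : s ≤ t) (h : (valueAt e n s).isSome) :
    (valueAt e n t).isSome := by
  obtain ⟨v, hv⟩ := Option.isSome_iff_exists.1 h
  exact Option.isSome_iff_exists.2 ⟨v, Code.evaln_mono hst hv⟩

/-- The stage after the last success of requirement `e` before stage `s`, or `0`. -/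
def lastSuccess (b : ℕ → ℕ) (e : ℕ) : ℕ → ℕ
  | 0 => 0
  | s + 1 =>
    if (∀ t < s, b t ≠ b s) ∧ (valueAt e (Nat.pair e (b s)) s).isSome ∧ lastSuccess b e s ≤ b s
    then s + 1 else lastSuccess b e s

/-- Requirement `e` succeeds at stage `s`: the number `b s` is enumerated for the first time, the
computation of requirement `e` for it has converged, and it exceeds all earlier successes. -/
def Success (b : ℕ → ℕ) (e s : ℕ) : Prop :=
  (∀ t < s, b t ≠ b s) ∧ (valueAt e (Nat.pair e (b s)) s).isSome ∧ lastSuccess b e s ≤ b s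

instance (b : ℕ → ℕ) (e s : ℕ) : Decidable (Success b e s) := by
  unfold Success; infer_instance

theorem lastSuccess_succ (b : ℕ → ℕ) (e s : ℕ) :
    lastSuccess b e (s + 1) = if Success b e s then s + 1 else lastSuccess b e s := rfl

theorem lastSuccess_le (b : ℕ → ℕ) (e s : ℕ) : lastSuccess b e s ≤ s := by
  induction s with
  | zero => rfl
  | succ s ih => rw [lastSuccess_succ]; split_ifs <;> omega

theorem lastSuccess_mono (b : ℕ → ℕ) (e : ℕ) : Monotone (lastSuccess b e) := by
  refine monotone_nat_of_le_succ fun s => ?_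
  have := lastSuccess_le b e s
  rw [lastSuccess_succ]; split_ifs <;> omega

theorem Success.lt_lastSuccess {b : ℕ → ℕ} {e t s : ℕ} (h : Success b e t) (hts : t < s) :
    t < lastSuccess b e s := by
  have : lastSuccess b e (t + 1) = t + 1 := by rw [lastSuccess_succ, if_pos h]
  have : lastSuccess b e (t + 1) ≤ lastSuccess b e s := lastSuccess_mono b e hts
  omega

theorem computablePred_fresh {b : ℕ → ℕ} (hb : Computable b) :
    ComputablePred fun s => ∀ t < s, b t ≠ b s :=
  ComputablePred.forall_lt (R := fun s t => b t ≠ b s)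
    (ComputablePred.eq (hb.comp Computable.snd) (hb.comp Computable.fst)).not Computable.id

theorem computablePred_ready {b : ℕ → ℕ} (hb : Computable b) :
    ComputablePred fun p : ℕ × ℕ => (valueAt p.1 (Nat.pair p.1 (b p.2)) p.2).isSome :=
  ComputablePred.eq (Primrec.option_isSome.to_comp.comp
    (computable_valueAt Computable.fst (Primrec₂.natPair.to_comp.comp Computable.fst
      (hb.comp Computable.snd)) Computable.snd)) (Computable.const true)

theorem computable_lastSuccess {b : ℕ → ℕ} (hb : Computable b) :
    Computable₂ (lastSuccess b) := by
  have hcond : ComputablePred fun a : (ℕ × ℕ) × ℕ × ℕ => (∀ t < a.2.1, b t ≠ b a.2.1) ∧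
      (valueAt a.1.1 (Nat.pair a.1.1 (b a.2.1)) a.2.1).isSome ∧ a.2.2 ≤ b a.2.1 :=
    ((computablePred_fresh hb).comp (Computable.fst.comp Computable.snd)).and
      (((computablePred_ready hb).comp ((Computable.fst.comp Computable.fst).pair
        (Computable.fst.comp Computable.snd))).and
        (ComputablePred.le (Computable.snd.comp Computable.snd)
          (hb.comp (Computable.fst.comp Computable.snd))))
  have hstep : Computable₂ fun (p : ℕ × ℕ) (q : ℕ × ℕ) =>
      cond (decide ((∀ t < q.1, b t ≠ b q.1) ∧
        (valueAt p.1 (Nat.pair p.1 (b q.1)) q.1).isSome ∧ q.2 ≤ b q.1)) (q.1 + 1) q.2 :=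
    Computable.cond (α := (ℕ × ℕ) × ℕ × ℕ) hcond.decide
      (Computable.succ.comp (Computable.fst.comp Computable.snd))
      (Computable.snd.comp Computable.snd)
  refine (Computable.nat_rec Computable.snd (Computable.const 0) hstep).of_eq ?_
  rintro ⟨e, s⟩
  induction s with
  | zero => rfl
  | succ s ih =>
    dsimp only at ih ⊢
    rw [ih, Bool.cond_decide]
    rfl

theorem computablePred_success {b : ℕ → ℕ} (hb : Computable b) :
    ComputablePred fun p : ℕ × ℕ => Success b p.1 p.2 :=
  ((computablePred_fresh hb).comp Computable.snd).and ((computablePred_ready hb).and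
    (ComputablePred.le (computable_lastSuccess hb) (hb.comp Computable.snd)))

/-- The `x`-th entry of the list computed by requirement `e` at `n`, if found in `s` steps. -/
def entryAt (e n s x : ℕ) : Option ℕ :=
  (valueAt e n s).bind fun v => (Denumerable.ofNat (List ℕ) v)[x]?

theorem computable_entryAt {α : Type*} [Primcodable α] {e n s x : α → ℕ} (he : Computable e)
    (hn : Computable n) (hs : Computable s) (hx : Computable x) :
    Computable fun a => entryAt (e a) (n a) (s a) (x a) := by
  have h : Computable₂ fun (a : α) (v : ℕ) => (Denumerable.ofNat (List ℕ) v)[x a]? :=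
    (Computable.list_getElem?.comp ((Computable.ofNat (List ℕ)).comp Computable.snd)
      (hx.comp Computable.fst) :)
  exact Computable.option_bind (computable_valueAt he hn hs) h

/-- The numbers enumerated by the requirements at their successes. -/
def successSet (b : ℕ → ℕ) : Set ℕ :=
  {x | ∃ s, b s = permit x ∧ Success b (requirement x) s ∧
    entryAt (requirement x) (block x) s x = some 0}

/-- A success at stage `t` forces every later success to enumerate a number greater than `t`. With
infinitely many successes, the first one at a stage at least `permit x` thus bounds the stages that
can concern `x`; with finitely many, a constant does. The case distinction is not uniform in `e`. -/
theorem computablePred_successSet_section {b : ℕ → ℕ} (hb : Computable b) (e : ℕ) :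
    ComputablePred fun x => requirement x = e ∧ x ∈ successSet b := by
  obtain ⟨f, hf, hfb⟩ : ∃ f : ℕ → ℕ, Computable f ∧
      ∀ x s, Success b e s → b s = permit x → s < f x := by
    by_cases h : ∀ N, ∃ s, N ≤ s ∧ Success b e s
    · have h' : ∀ x, ∃ s, permit x ≤ s ∧ Success b e s := fun x => h _
      refine ⟨fun x => Nat.find (h' x) + 1, Computable.succ.comp (Computable.find
        ((ComputablePred.le (computable_permit.comp Computable.fst) Computable.snd).and
          ((computablePred_success hb).comp
            ((Computable.const e).pair Computable.snd))) h'), fun x s hs hsx => ?_⟩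
      obtain ⟨h1, h2⟩ := Nat.find_spec (h' x)
      by_contra! hlt
      have := h2.lt_lastSuccess hlt
      have := hs.2.2
      omega
    · push Not at h
      obtain ⟨N, hN⟩ := h
      exact ⟨fun _ => N, Computable.const N, fun x s hs _ => not_le.1 fun hle => hN s hle hs⟩
  have hdec : ComputablePred fun x => ∃ s < f x, b s = permit x ∧ Success b e s ∧
      entryAt e (block x) s x = some 0 :=
    ComputablePred.exists_lt (R := fun x s => b s = permit x ∧ Success b e s ∧
      entryAt e (block x) s x = some 0)
      ((ComputablePred.eq (hb.comp Computable.snd) (computable_permit.comp Computable.fst)).and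
        (((computablePred_success hb).comp ((Computable.const e).pair Computable.snd)).and
          (ComputablePred.eq (computable_entryAt (Computable.const e)
            (computable_block.comp Computable.fst) Computable.snd Computable.fst)
            (Computable.const (some 0))))) hf
  refine ((ComputablePred.eq computable_requirement (Computable.const e)).and hdec).of_eq
    fun x => and_congr_right ?_
  rintro rfl
  constructor
  · rintro ⟨s, -, h⟩
    exact ⟨s, h⟩
  · rintro ⟨s, h⟩
    exact ⟨s, hfb x s h.2.1 h.1, h⟩

theorem computablePred_successSet_lt {b : ℕ → ℕ} (hb : Computable b) (k : ℕ) :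
    ComputablePred fun x => requirement x < k ∧ x ∈ successSet b := by
  induction k with
  | zero => simpa using ComputablePred.const False
  | succ k ih =>
    refine (ih.or (computablePred_successSet_section hb k)).of_eq fun x => ?_
    rw [Nat.lt_succ_iff_lt_or_eq]
    tauto

/-- A requirement that converges on almost all blocks has infinitely many successes, provided
that the permitting set is not computable. -/
theorem exists_success_ge {b : ℕ → ℕ} (hb : Computable b)
    (hrange : ¬ ComputablePred (· ∈ Set.range b)) {e m₀ : ℕ}
    (he : ∀ m ≥ m₀, ∃ s, (valueAt e (Nat.pair e m) s).isSome) (N : ℕ) :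
    ∃ s ≥ N, Success b e s := by
  by_contra! hN
  have hlast : ∀ s, lastSuccess b e s ≤ N := by
    intro s
    induction s with
    | zero => exact Nat.zero_le _
    | succ s ih =>
      rw [lastSuccess_succ]
      split_ifs with h
      · exact not_lt.1 fun h' => hN s (by omega) h
      · exact ih
  obtain ⟨M, hM⟩ : ∃ M, ∀ m < max N m₀, m ∈ Set.range b → ∃ s < M, b s = m := by
    induction max N m₀ with
    | zero => exact ⟨0, by simp⟩
    | succ k ih =>
      obtain ⟨M, hM⟩ := ih
      by_cases hk : k ∈ Set.range b
      · obtain ⟨s, hs⟩ := hk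
        refine ⟨max M (s + 1), fun m hm hmb => ?_⟩
        rcases Nat.lt_succ_iff_lt_or_eq.1 hm with h | rfl
        · obtain ⟨t, ht, htm⟩ := hM m h hmb
          exact ⟨t, by omega, htm⟩
        · exact ⟨s, by omega, hs⟩
      · refine ⟨M, fun m hm hmb => hM m ?_ hmb⟩
        rcases Nat.lt_succ_iff_lt_or_eq.1 hm with h | rfl
        · exact h
        · exact absurd hmb hk
  have hstage : ∀ m, ∃ s, m < m₀ ∨ (valueAt e (Nat.pair e m) s).isSome := by
    intro m
    by_cases h : m < m₀
    · exact ⟨0, .inl h⟩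
    · exact (he m (not_lt.1 h)).imp fun s hs => .inr hs
  have hcomp : Computable fun m => Nat.find (hstage m) :=
    Computable.find ((ComputablePred.lt Computable.fst (Computable.const m₀)).or
      (ComputablePred.eq (Primrec.option_isSome.to_comp.comp
        (computable_valueAt (Computable.const e) (Primrec₂.natPair.to_comp.comp
          (Computable.const e) Computable.fst) Computable.snd)) (Computable.const true))) hstage
  -- A number `m ≥ max N m₀` that first appears after stage `N` and after its computation has
  -- converged would be a success at a stage beyond `N`. So a bounded search decides `B`; the
  -- summand `M` covers the finitely many smaller `m`.
  refine hrange ((ComputablePred.exists_lt (R := fun m s => b s = m)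
    (ComputablePred.eq (hb.comp Computable.snd) Computable.fst)
    (Primrec.nat_add.to_comp.comp hcomp (Computable.const (N + M)))).of_eq fun m => ?_)
  constructor
  · rintro ⟨s, -, h⟩
    exact ⟨s, h⟩
  · intro hm
    by_cases hlt : m < max N m₀
    · obtain ⟨s, hs, hsm⟩ := hM m hlt hm
      exact ⟨s, by omega, hsm⟩
    · have hs : b (Nat.find hm) = m := Nat.find_spec hm
      have hmin : ∀ t < Nat.find hm, b t ≠ m := fun t ht => Nat.find_min hm ht
      refine ⟨Nat.find hm, ?_, hs⟩
      by_contra! hle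
      refine hN (Nat.find hm) (by omega) ⟨by rwa [hs], ?_, ?_⟩
      · rw [hs]
        refine isSome_valueAt_mono (s := Nat.find (hstage m)) (by omega) ?_
        exact (Nat.find_spec (hstage m)).resolve_left (by omega)
      · rw [hs]
        exact (hlast _).trans (by omega)

/-- Every partial computable function is simulated by some requirement: either it diverges on
infinitely many blocks of this requirement, or on infinitely many of these blocks the enumeration
follows the list that it computes. -/
theorem exists_requirement {b : ℕ → ℕ} (hb : Computable b)
    (hrange : ¬ ComputablePred (· ∈ Set.range b)) {Φ : ℕ →. List ℕ} (hΦ : Partrec Φ) :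
    ∃ e, (∃ᶠ m in atTop, ¬ (Φ (Nat.pair e m)).Dom) ∨
      ∃ᶠ m in atTop, ∃ l ∈ Φ (Nat.pair e m), ∀ x, block x = Nat.pair e m →
        (x ∈ successSet b ↔ l[x]? = some 0) := by
  obtain ⟨c, hc⟩ := Code.exists_code.1 (Partrec.nat_iff.1 (Partrec.map_encode_iff.2 hΦ))
  refine ⟨Encodable.encode c, or_iff_not_imp_left.2 fun h => ?_⟩
  set e := Encodable.encode c with hedef
  have hval : ∀ n s v, valueAt e n s = some v → ∃ l ∈ Φ n, Denumerable.ofNat (List ℕ) v = l := by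
    intro n s v hv
    have := Code.evaln_sound hv
    rw [hedef, Denumerable.ofNat_encode, hc] at this
    obtain ⟨l, hl, rfl⟩ := (Part.mem_map_iff _).1 this
    exact ⟨l, hl, Denumerable.ofNat_encode l⟩
  rw [not_frequently] at h
  obtain ⟨m₀, hm₀⟩ := eventually_atTop.1 h
  have hsucc := exists_success_ge (e := e) hb hrange (m₀ := m₀) fun m hm => by
    obtain ⟨l, hl⟩ := Part.dom_iff_mem.1 (not_not.1 (hm₀ m hm))
    have : Encodable.encode l ∈ (Denumerable.ofNat Code e).eval (Nat.pair e m) := by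
      rw [hedef, Denumerable.ofNat_encode, hc]
      exact Part.mem_map _ hl
    obtain ⟨s, hs⟩ := Code.evaln_complete.1 this
    exact ⟨s, Option.isSome_iff_exists.2 ⟨_, hs⟩⟩
  refine frequently_atTop.2 fun M => ?_
  -- The blocks must be unbounded, not just the stages: after a success at `t ≥ M`, the next one has
  -- `b s > t`.
  obtain ⟨t, htM, ht⟩ := hsucc M
  obtain ⟨s, hst, hs⟩ := hsucc (t + 1)
  have h1 := ht.lt_lastSuccess (s := s) (by omega)
  have h2 := hs.2.2
  refine ⟨b s, by omega, ?_⟩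
  obtain ⟨v, hv⟩ := Option.isSome_iff_exists.1 hs.2.1
  obtain ⟨l, hl, hvl⟩ := hval _ _ _ hv
  refine ⟨l, hl, fun x hx => ?_⟩
  have hreq : requirement x = e := by simp [requirement, hx]
  have hper : permit x = b s := by simp [permit, hx]
  constructor
  · rintro ⟨s', -, -, h'⟩
    rw [hreq, hx] at h'
    obtain ⟨v', hv', h'⟩ := Option.bind_eq_some_iff.1 h'
    obtain ⟨l', hl', rfl⟩ := hval _ _ _ hv'
    rwa [Part.mem_unique hl hl']
  · intro h'
    refine ⟨s, hper.symm, hreq ▸ hs, ?_⟩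
    rw [hreq, hx, entryAt, hv, Option.bind_some, hvl, h']

/-! ### The diagonal set and its degree. -/

/-- The set that codes `range b` on the squares and that follows the successes of requirement `e`
off `D e`. -/
def diagSet (b : ℕ → ℕ) (D : ℕ → Set ℕ) : Set ℕ :=
  {x | (x = x.sqrt * x.sqrt ∧ x.sqrt ∈ Set.range b) ∨
    (x ≠ x.sqrt * x.sqrt ∧ x ∉ D (requirement x) ∧ x ∈ successSet b)}

theorem computablePred_isSquare : ComputablePred fun x : ℕ => x = x.sqrt * x.sqrt :=
  ComputablePred.eq Computable.id
    (Primrec.nat_mul.comp Primrec.nat_sqrt Primrec.nat_sqrt).to_comp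

theorem diagSet_reducible {b : ℕ → ℕ} (hb : Computable b) {D : ℕ → Set ℕ}
    (hD : ComputablePred fun p : ℕ × ℕ => p.2 ∈ D p.1) :
    REPred (· ∈ diagSet b D) ∧ TuringReducible (fun n => Part.some (charFn (diagSet b D) n))
      (fun n => Part.some (charFn (Set.range b) n)) := by
  refine turingReducible_of_firstStage hb
    (q := fun x => if x = x.sqrt * x.sqrt then x.sqrt else permit x)
    (P := fun x s => x = x.sqrt * x.sqrt ∨ (x ∉ D (requirement x) ∧ Success b (requirement x) s ∧
      entryAt (requirement x) (block x) s x = some 0)) ?_ ?_ ?_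
  · exact ComputablePred.ite Primrec.nat_sqrt.to_comp computable_permit computablePred_isSquare
  · have hr : Computable fun p : ℕ × ℕ => requirement p.1 :=
      computable_requirement.comp Computable.fst
    exact (computablePred_isSquare.comp Computable.fst).or
      ((hD.comp (hr.pair Computable.fst)).not.and
        (((computablePred_success hb).comp (hr.pair Computable.snd)).and
          (ComputablePred.eq (computable_entryAt hr (computable_block.comp Computable.fst)
            Computable.snd Computable.fst) (Computable.const (some 0)))))
  · intro x
    by_cases hx : x = x.sqrt * x.sqrt
    · simp only [diagSet, Set.mem_ofPred_eq, eq_true hx, true_and, true_or, and_true,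
        not_true_eq_false, ne_eq, false_and, or_false]
      refine ⟨fun h => ⟨Nat.find h, fun t ht => Nat.find_min h ht, Nat.find_spec h⟩, ?_⟩
      rintro ⟨s, -, h⟩
      exact ⟨s, h⟩
    · simp only [diagSet, Set.mem_ofPred_eq, eq_false hx, false_and, false_or, ne_eq,
        not_false_eq_true, true_and, successSet]
      constructor
      · rintro ⟨h1, s, h2, h3, h4⟩
        -- Freshness is part of `Success`, so `s` is the first stage that enumerates `permit x`.
        exact ⟨s, h2 ▸ h3.1, h2, h1, h3, h4⟩
      · rintro ⟨s, -, h2, h1, h3, h4⟩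
        exact ⟨h1, s, h2, h3, h4⟩

theorem range_reducible_diagSet (b : ℕ → ℕ) (D : ℕ → Set ℕ) :
    TuringReducible (fun n => Part.some (charFn (Set.range b) n))
      (fun n => Part.some (charFn (diagSet b D) n)) := by
  refine turingReducible_of_query (q := fun n => n * n)
    (Primrec.nat_mul.comp Primrec.id Primrec.id).to_comp (G := fun p => Part.some p.1)
    Computable.fst fun x => ?_
  have : x * x ∈ diagSet b D ↔ x ∈ Set.range b := by simp [diagSet]
  rw [Part.mem_some_iff]
  by_cases hx : x ∈ Set.range b
  · rw [charFn_of_mem hx, charFn_of_mem (this.2 hx)]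
  · rw [charFn_of_notMem hx, charFn_of_notMem (mt this.1 hx)]

/-- By monotonicity, `x ∈ D k` and `x ∉ D (requirement x)` force `requirement x < k`. Only finitely
many requirements act on `D k`, and `D k` avoids the coding squares. -/
theorem computablePred_diagSet_inter {b : ℕ → ℕ} (hb : Computable b) {D : ℕ → Set ℕ}
    (hD : ComputablePred fun p : ℕ × ℕ => p.2 ∈ D p.1) (hmono : Monotone D)
    (hsq : ∀ e, ∀ x ∈ D e, x ≠ x.sqrt * x.sqrt) (k : ℕ) :
    ComputablePred (· ∈ diagSet b D ∩ D k) := by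
  refine ((hD.comp (Computable.pair (Computable.const k) Computable.id)).and
    ((hD.comp (computable_requirement.pair Computable.id)).not.and
      (computablePred_successSet_lt hb k))).of_eq fun x => ?_
  simp only [id, diagSet, Set.mem_inter_iff, Set.mem_ofPred_eq]
  constructor
  · rintro ⟨h1, h2, -, h4⟩
    exact ⟨.inr ⟨hsq k x h1, h2, h4⟩, h1⟩
  · rintro ⟨⟨h, -⟩ | ⟨-, h2, h4⟩, h1⟩
    · exact absurd h (hsq k x h1)
    · exact ⟨h1, h2, not_le.1 fun h => h2 (hmono h h1), h4⟩

/-! ### Lower density. -/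

theorem densityBelow_nonneg (X : Set ℕ) (n : ℕ) : 0 ≤ densityBelow X n := by
  unfold densityBelow; positivity

theorem ncard_inter_Iio_le (X : Set ℕ) (n : ℕ) : (X ∩ Set.Iio n).ncard ≤ n := by
  refine (Set.ncard_le_ncard Set.inter_subset_right (Set.finite_Iio n)).trans ?_
  simp [Set.ncard_eq_toFinset_card']

theorem densityBelow_le_one (X : Set ℕ) (n : ℕ) : densityBelow X n ≤ 1 := by
  refine div_le_one_of_le₀ ?_ n.cast_nonneg
  exact_mod_cast ncard_inter_Iio_le X n

theorem isBoundedUnder_densityBelow (X : Set ℕ) :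
    IsBoundedUnder (· ≥ ·) atTop (densityBelow X) :=
  isBoundedUnder_of ⟨0, densityBelow_nonneg X⟩

theorem isCoboundedUnder_densityBelow (X : Set ℕ) :
    IsCoboundedUnder (· ≥ ·) atTop (densityBelow X) :=
  (isBoundedUnder_of ⟨1, densityBelow_le_one X⟩ :
    IsBoundedUnder (· ≤ ·) atTop (densityBelow X)).isCoboundedUnder_ge

theorem densityBelow_mono {X Y : Set ℕ} (h : X ⊆ Y) (n : ℕ) :
    densityBelow X n ≤ densityBelow Y n := by
  unfold densityBelow
  gcongr
  exact (Set.finite_Iio n).subset Set.inter_subset_right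

theorem lowerDensity_mono {X Y : Set ℕ} (h : X ⊆ Y) : lowerDensity X ≤ lowerDensity Y :=
  liminf_le_liminf (.of_forall (densityBelow_mono h)) (isBoundedUnder_densityBelow X)
    (isCoboundedUnder_densityBelow Y)

theorem lowerDensity_le_of_frequently {X : Set ℕ} {c : ℝ}
    (h : ∃ᶠ n in atTop, densityBelow X n ≤ c) : lowerDensity X ≤ c :=
  liminf_le_of_frequently_le h (isBoundedUnder_densityBelow X)

theorem le_lowerDensity_of_tendsto {X : Set ℕ} {c : ℝ} {g : ℕ → ℝ}
    (hg : Tendsto g atTop (𝓝 c)) (h : ∀ᶠ n in atTop, g n ≤ densityBelow X n) :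
    c ≤ lowerDensity X := by
  rw [← hg.liminf_eq]
  exact liminf_le_liminf h hg.isBoundedUnder_ge (isCoboundedUnder_densityBelow X)

/-! ### Wedges of prescribed density. -/

/-- The nonsquares `j ^ 2 + i` with `0 < i < ρ * (2 * j + 1)`, `j = √x`, a set of density `ρ`. -/
def wedge (ρ : ℝ) : Set ℕ :=
  {x | 0 < x - x.sqrt * x.sqrt ∧ ((x - x.sqrt * x.sqrt : ℕ) : ℝ) < ρ * (2 * x.sqrt + 1)}

theorem ncard_wedge_step {ρ : ℝ} (h1 : ρ ≤ 1) (j : ℕ) :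
    (wedge ρ ∩ Set.Iio ((j + 1) * (j + 1))).ncard =
      (wedge ρ ∩ Set.Iio (j * j)).ncard + (⌈ρ * (2 * j + 1)⌉₊ - 1) := by
  have hceil : ⌈ρ * (2 * j + 1)⌉₊ ≤ 2 * j + 1 := by
    rw [Nat.ceil_le]
    push_cast
    nlinarith [(Nat.cast_nonneg j : (0 : ℝ) ≤ j)]
  have hunion : wedge ρ ∩ Set.Iio ((j + 1) * (j + 1)) = (wedge ρ ∩ Set.Iio (j * j)) ∪
      ↑((Finset.Ico 1 ⌈ρ * (2 * j + 1)⌉₊).image (j * j + ·)) := by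
    ext x
    simp only [Set.mem_inter_iff, Set.mem_Iio, Set.mem_union, Finset.coe_image, Set.mem_image,
      Finset.coe_Ico, Set.mem_Ico]
    constructor
    · rintro ⟨hx, hlt⟩
      by_cases hxj : x < j * j
      · exact .inl ⟨hx, hxj⟩
      · have hs : x.sqrt = j := by
          have h1 := Nat.sqrt_lt.2 hlt
          have h2 := Nat.le_sqrt.2 (not_lt.1 hxj)
          omega
        obtain ⟨hx1, hx2⟩ := hx
        rw [hs] at hx1 hx2
        exact .inr ⟨x - j * j, ⟨hx1, Nat.lt_ceil.2 hx2⟩, by omega⟩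
    · rintro (⟨hx, hlt⟩ | ⟨i, ⟨hi1, hi2⟩, rfl⟩)
      · exact ⟨hx, hlt.trans (by nlinarith)⟩
      · have hs : (j * j + i).sqrt = j := Nat.sqrt_add_eq j (by omega)
        refine ⟨⟨?_, ?_⟩, by nlinarith⟩
        · rw [hs]; omega
        · rw [hs, Nat.add_sub_cancel_left]
          exact Nat.lt_ceil.1 hi2
  rw [hunion, Set.ncard_union_eq, Set.ncard_coe_finset,
    Finset.card_image_of_injective _ (add_right_injective _), Nat.card_Ico]
  · rw [Set.disjoint_left]
    rintro x ⟨-, hx⟩ hx'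
    obtain ⟨i, -, rfl⟩ := Finset.mem_image.1 (Finset.mem_coe.1 hx')
    exact absurd (Set.mem_Iio.1 hx) (by simp)

theorem ncard_wedge_le {ρ : ℝ} (h0 : 0 ≤ ρ) (h1 : ρ ≤ 1) (j : ℕ) :
    ((wedge ρ ∩ Set.Iio (j * j)).ncard : ℝ) ≤ ρ * (j * j) := by
  induction j with
  | zero => simp
  | succ j ih =>
    have hpos : 0 ≤ ρ * (2 * j + 1) := by positivity
    have : ((⌈ρ * (2 * j + 1)⌉₊ - 1 : ℕ) : ℝ) ≤ ρ * (2 * j + 1) := by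
      rcases Nat.eq_zero_or_pos ⌈ρ * (2 * j + 1)⌉₊ with h | h
      · rw [h]; simpa using hpos
      · rw [Nat.cast_sub h]
        have := Nat.ceil_lt_add_one hpos
        push_cast
        linarith
    rw [ncard_wedge_step h1]
    push_cast
    linarith

theorem le_ncard_wedge {ρ : ℝ} (h1 : ρ ≤ 1) (j : ℕ) :
    ρ * (j * j) - j ≤ ((wedge ρ ∩ Set.Iio (j * j)).ncard : ℝ) := by
  induction j with
  | zero => simp
  | succ j ih =>
    have : ρ * (2 * j + 1) - 1 ≤ ((⌈ρ * (2 * j + 1)⌉₊ - 1 : ℕ) : ℝ) := by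
      have h := Nat.le_ceil (ρ * (2 * j + 1))
      have h' : (⌈ρ * (2 * j + 1)⌉₊ : ℝ) ≤ ((⌈ρ * (2 * j + 1)⌉₊ - 1 : ℕ) : ℝ) + 1 := by
        exact_mod_cast (by omega : ⌈ρ * (2 * j + 1)⌉₊ ≤ ⌈ρ * (2 * j + 1)⌉₊ - 1 + 1)
      linarith
    rw [ncard_wedge_step h1]
    push_cast
    linarith

theorem le_lowerDensity_wedge {ρ : ℝ} (h0 : 0 ≤ ρ) (h1 : ρ ≤ 1) : ρ ≤ lowerDensity (wedge ρ) := by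
  -- With `j = √n` rounded down, rounding on the intervals `[j², (j+1)²)` costs at most `j` and the
  -- incomplete last interval at most `2 * j`. Hence the constant `3`.
  have hlim : Tendsto (fun n : ℕ => ρ - 3 * (Real.sqrt n)⁻¹) atTop (𝓝 ρ) := by
    have : Tendsto (fun n : ℕ => (Real.sqrt n)⁻¹) atTop (𝓝 0) :=
      tendsto_inv_atTop_zero.comp (Real.tendsto_sqrt_atTop.comp tendsto_natCast_atTop_atTop)
    simpa using (this.const_mul 3).const_sub ρ
  refine le_lowerDensity_of_tendsto hlim ?_
  filter_upwards [eventually_ge_atTop 1] with n hn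
  have hn0 : (0 : ℝ) < n := by exact_mod_cast hn
  set s := Real.sqrt n
  have hs : 0 < s := Real.sqrt_pos.2 hn0
  have hss : s * s = n := Real.mul_self_sqrt hn0.le
  have hjs : (n.sqrt : ℝ) ≤ s := Real.nat_sqrt_le_real_sqrt
  have hlt : (n : ℝ) ≤ n.sqrt * n.sqrt + 2 * n.sqrt := by
    exact_mod_cast (by have := Nat.sqrt_le_add n; omega : n ≤ n.sqrt * n.sqrt + 2 * n.sqrt)
  have hcard := le_ncard_wedge h1 n.sqrt
  have hle : ((wedge ρ ∩ Set.Iio (n.sqrt * n.sqrt)).ncard : ℝ) ≤ (wedge ρ ∩ Set.Iio n).ncard := by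
    exact_mod_cast Set.ncard_le_ncard
      (Set.inter_subset_inter_right _ (Set.Iio_subset_Iio (Nat.sqrt_le n)))
      ((Set.finite_Iio n).subset Set.inter_subset_right)
  rw [densityBelow, le_div_iff₀ hn0]
  have h3 : 3 * s⁻¹ * n = 3 * s := by
    rw [← hss]; field_simp
  rw [sub_mul, h3]
  have : ρ * n ≤ ρ * (n.sqrt * n.sqrt + 2 * n.sqrt) := mul_le_mul_of_nonneg_left hlt h0
  have : ρ * n.sqrt ≤ n.sqrt := mul_le_of_le_one_left (Nat.cast_nonneg _) h1
  linarith

theorem ncard_square_inter_Iio_le (N : ℕ) :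
    ({x : ℕ | x = x.sqrt * x.sqrt} ∩ Set.Iio (N * N)).ncard ≤ N := by
  have hsub : {x : ℕ | x = x.sqrt * x.sqrt} ∩ Set.Iio (N * N) ⊆
      ↑((Finset.range N).image fun j => j * j) := by
    rintro x ⟨hx, hlt⟩
    exact Finset.mem_coe.2 (Finset.mem_image.2
      ⟨x.sqrt, Finset.mem_range.2 (Nat.sqrt_lt.2 hlt), Eq.symm hx⟩)
  refine (Set.ncard_le_ncard hsub (Finset.finite_toSet _)).trans ?_
  rw [Set.ncard_coe_finset]
  exact Finset.card_image_le.trans (by simp)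

/-- A set that meets the blocks `[n! ^ 2, (n+1)! ^ 2)` only in squares and in a wedge of density
`ρ < ρ'` has density at most `ρ'` at the ends of all late blocks. -/
theorem eventually_densityBelow_le {ρ ρ' : ℝ} (h0 : 0 ≤ ρ) (h1 : ρ ≤ 1) (hρ : ρ < ρ') :
    ∀ᶠ n : ℕ in atTop, ∀ X : Set ℕ, (∀ x ∈ X, n ! * n ! ≤ x → x < (n + 1)! * (n + 1)! →
      x ≠ x.sqrt * x.sqrt → x ∈ wedge ρ) → densityBelow X ((n + 1)! * (n + 1)!) ≤ ρ' := by
  -- For `N = (n+1)!`, both the earlier blocks (`n!²` numbers) and the squares (at most `N`)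
  -- contribute at most `N² / (n+1)`.
  have hlim : Tendsto (fun n : ℕ => 2 * (1 / ((n : ℝ) + 1))) atTop (𝓝 0) := by
    simpa using tendsto_one_div_add_atTop_nhds_zero_nat.const_mul (2 : ℝ)
  filter_upwards [hlim.eventually (gt_mem_nhds (sub_pos.2 hρ))] with n hn X hX
  set N := (n + 1)! with hN
  have hNpos : (0 : ℝ) < N := by exact_mod_cast Nat.factorial_pos _
  have hNeq : (N : ℝ) = (n + 1) * n ! := by rw [hN, Nat.factorial_succ]; push_cast; rfl
  have hsub : X ∩ Set.Iio (N * N) ⊆ (Set.Iio (n ! * n !) ∪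
      ({x : ℕ | x = x.sqrt * x.sqrt} ∩ Set.Iio (N * N))) ∪ (wedge ρ ∩ Set.Iio (N * N)) := by
    rintro x ⟨hx, hlt⟩
    by_cases h : x < (n ! * n !)
    · exact .inl (.inl h)
    · by_cases hsq : x = x.sqrt * x.sqrt
      · exact .inl (.inr ⟨hsq, hlt⟩)
      · exact .inr ⟨hX x hx (not_lt.1 h) hlt hsq, hlt⟩
  have hcard : (X ∩ Set.Iio (N * N)).ncard ≤
      n ! * n ! + N + (wedge ρ ∩ Set.Iio (N * N)).ncard := by
    refine (Set.ncard_le_ncard hsub (((Set.finite_Iio _).union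
      ((Set.finite_Iio _).subset Set.inter_subset_right)).union
        ((Set.finite_Iio _).subset Set.inter_subset_right))).trans ?_
    refine (Set.ncard_union_le _ _).trans (Nat.add_le_add_right
      ((Set.ncard_union_le _ _).trans (Nat.add_le_add ?_ (ncard_square_inter_Iio_le N))) _)
    simp [Set.ncard_eq_toFinset_card']
  have hcard' : ((X ∩ Set.Iio (N * N)).ncard : ℝ) ≤ n ! * n ! + N + ρ * (N * N) := by
    have h := ncard_wedge_le h0 h1 N
    have h' : ((X ∩ Set.Iio (N * N)).ncard : ℝ) ≤
      n ! * n ! + N + (wedge ρ ∩ Set.Iio (N * N)).ncard := by exact_mod_cast hcard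
    linarith
  have hn1 : (0 : ℝ) < n + 1 := by positivity
  have hf1 : (1 : ℝ) ≤ n ! := by exact_mod_cast Nat.factorial_pos n
  have hkey : (n ! * n ! + N : ℝ) ≤ 2 * (1 / ((n : ℝ) + 1)) * (N * N) := by
    have e1 : 2 * (1 / ((n : ℝ) + 1)) * (N * N) = 2 * (n ! * ((n + 1) * n !)) := by
      rw [hNeq]; field_simp
    rw [e1, hNeq]
    have h2 : (n ! : ℝ) * n ! ≤ n ! * ((n + 1) * n !) := by
      refine mul_le_mul_of_nonneg_left ?_ (by positivity)
      nlinarith [(Nat.cast_nonneg n : (0 : ℝ) ≤ n)]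
    have h3 : ((n : ℝ) + 1) * n ! ≤ n ! * ((n + 1) * n !) :=
      le_mul_of_one_le_left (by positivity) hf1
    linarith
  rw [densityBelow, div_le_iff₀ (by push_cast; positivity)]
  push_cast
  have h4 : 2 * (1 / ((n : ℝ) + 1)) * (N * N) ≤ (ρ' - ρ) * (N * N) :=
    mul_le_mul_of_nonneg_right hn.le (by positivity)
  linarith

theorem wedge_mono {ρ ρ' : ℝ} (h : ρ ≤ ρ') : wedge ρ ⊆ wedge ρ' := fun _ hx =>
  ⟨hx.1, hx.2.trans_le (mul_le_mul_of_nonneg_right h (by positivity))⟩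

theorem wedge_eq_empty {ρ : ℝ} (h : ρ ≤ 0) : wedge ρ = ∅ := by
  refine Set.eq_empty_of_forall_notMem fun x hx => ?_
  have h1 : ρ * (2 * x.sqrt + 1) ≤ 0 := mul_nonpos_of_nonpos_of_nonneg h (by positivity)
  exact absurd hx.2 (not_lt.2 (h1.trans (Nat.cast_nonneg _)))

theorem ne_square_of_mem_wedge {ρ : ℝ} {x : ℕ} (hx : x ∈ wedge ρ) : x ≠ x.sqrt * x.sqrt := by
  have := hx.1
  omega

/-! ### Computable reals and computable wedges. -/

theorem computable_pow {α : Type*} [Primcodable α] (a : ℕ) {f : α → ℕ} (hf : Computable f) :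
    Computable fun x => a ^ f x :=
  ((Primrec₂.unpaired'.1 Nat.Primrec.pow).to_comp.comp (Computable.const a) hf :)

/-- A computable real is the limit of smaller reals whose wedges are uniformly
computable. -/
theorem IsComputableReal.exists_wedges {r : ℝ} (hr : IsComputableReal r) :
    ∃ c : ℕ → ℝ, (∀ k, c k < r) ∧ (∀ w < r, ∃ k, w < c k) ∧
      ComputablePred fun p : ℕ × ℕ => p.2 ∈ wedge (c p.1) := by
  obtain ⟨s, p, q, hs, hp, hq, hq0, happrox⟩ := hr
  -- Subtracting twice the error bound puts `c k` strictly below `r` and within `3 * (1/2)^k` of it.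
  refine ⟨fun k => (-1 : ℝ) ^ s k * p k / q k - 2 * (1 / 2) ^ k, fun k => ?_, fun w hw => ?_, ?_⟩
  · have h1 := (abs_le.1 (happrox k)).2
    have h2 : (0 : ℝ) < (1 / 2) ^ k := by positivity
    linarith
  · obtain ⟨k, hk⟩ := exists_pow_lt_of_lt_one (show (0 : ℝ) < (r - w) / 3 by linarith)
      (by norm_num : (1 / 2 : ℝ) < 1)
    refine ⟨k, ?_⟩
    have h1 := (abs_le.1 (happrox k)).1
    linarith
  · have hdec : ComputablePred fun a : ℕ × ℕ => s a.1 % 2 = 0 ∧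
        0 < a.2 - a.2.sqrt * a.2.sqrt ∧
        (a.2 - a.2.sqrt * a.2.sqrt) * (q a.1 * 2 ^ a.1) + 2 * (q a.1 * (2 * a.2.sqrt + 1)) <
          p a.1 * (2 ^ a.1 * (2 * a.2.sqrt + 1)) := by
      have hmul := Primrec.nat_mul.to_comp
      have hsq : Computable fun a : ℕ × ℕ => a.2.sqrt :=
        Primrec.nat_sqrt.to_comp.comp Computable.snd
      have hi : Computable fun a : ℕ × ℕ => a.2 - a.2.sqrt * a.2.sqrt :=
        Primrec.nat_sub.to_comp.comp Computable.snd (hmul.comp hsq hsq)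
      have hw : Computable fun a : ℕ × ℕ => 2 * a.2.sqrt + 1 :=
        Computable.succ.comp (hmul.comp (Computable.const 2) hsq)
      have hpow : Computable fun a : ℕ × ℕ => 2 ^ a.1 := computable_pow 2 Computable.fst
      have hq' : Computable fun a : ℕ × ℕ => q a.1 := hq.comp Computable.fst
      refine (ComputablePred.eq (Primrec.nat_mod.to_comp.comp (hs.comp Computable.fst)
        (Computable.const 2)) (Computable.const 0)).and ((ComputablePred.lt (Computable.const 0)
          hi).and (ComputablePred.lt ?_ ?_))
      · exact Primrec.nat_add.to_comp.comp (hmul.comp hi (hmul.comp hq' hpow))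
          (hmul.comp (Computable.const 2) (hmul.comp hq' hw))
      · exact hmul.comp (hp.comp Computable.fst) (hmul.comp hpow hw)
    refine hdec.of_eq ?_
    rintro ⟨k, x⟩
    have hqpos : (0 : ℝ) < q k := by exact_mod_cast Nat.pos_of_ne_zero (hq0 k)
    have h2pos : (0 : ℝ) < 2 ^ k := by positivity
    dsimp only
    by_cases hpar : s k % 2 = 0
    · rw [(Nat.even_iff.2 hpar).neg_one_pow, one_mul]
      simp only [hpar, true_and, wedge, Set.mem_ofPred_eq]
      refine and_congr_right fun _ => ?_
      have e : ((p k : ℝ) / q k - 2 * (1 / 2) ^ k) * (2 * x.sqrt + 1) =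
          (p k * (2 ^ k * (2 * x.sqrt + 1)) - 2 * (q k * (2 * x.sqrt + 1))) / (q k * 2 ^ k) := by
        rw [one_div, inv_pow]
        field_simp
      rw [e, lt_div_iff₀ (by positivity), lt_sub_iff_add_lt]
      exact_mod_cast Iff.rfl
    -- For odd `s k` the approximation is at most `0`, so no integer test is needed.
    · rw [wedge_eq_empty]
      · simp [hpar]
      · rw [(Nat.odd_iff.2 (Nat.mod_two_ne_zero.1 hpar)).neg_one_pow]
        have h1 : 0 ≤ (p k : ℝ) / q k := by positivity
        have h2 : (0 : ℝ) < (1 / 2) ^ k := by positivity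
        rw [neg_one_mul, neg_div]
        linarith

/-! ### Diagonalization against coarse and partial algorithms. -/

theorem block_eq {n x : ℕ} (h₁ : n ! * n ! ≤ x) (h₂ : x < (n + 1)! * (n + 1)!) : block x = n :=
  blockIndex_eq (Nat.le_sqrt.2 h₁) (Nat.sqrt_lt.2 h₂)

theorem tendsto_factorial_succ_mul_self :
    Tendsto (fun n : ℕ => (n + 1)! * (n + 1)!) atTop atTop :=
  tendsto_atTop_mono (fun n => (Nat.le_succ n).trans ((Nat.self_le_factorial _).trans
    (Nat.le_mul_self _))) tendsto_id

theorem tendsto_pair (e : ℕ) : Tendsto (Nat.pair e) atTop atTop :=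
  tendsto_atTop_mono (Nat.right_le_pair e) tendsto_id

/-- A set that meets infinitely many blocks of a requirement only in squares and in a wedge of
density `ρ` has lower density less than any `r > ρ`. -/
theorem lowerDensity_lt_of_frequently {X : Set ℕ} {ρ r : ℝ} (h0 : 0 ≤ ρ) (h1 : ρ ≤ 1) (hρ : ρ < r)
    {e : ℕ} (h : ∃ᶠ m in atTop, ∀ x ∈ X, block x = Nat.pair e m → x ≠ x.sqrt * x.sqrt →
      x ∈ wedge ρ) : lowerDensity X < r := by
  obtain ⟨ρ', hρ', hρr⟩ := exists_between hρ
  refine lt_of_le_of_lt (lowerDensity_le_of_frequently ?_) hρr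
  refine (tendsto_factorial_succ_mul_self.comp (tendsto_pair e)).frequently
    ((h.and_eventually ((tendsto_pair e).eventually
      (eventually_densityBelow_le h0 h1 hρ'))).mono ?_)
  rintro m ⟨hm, hm'⟩
  exact hm' X fun x hx hx1 hx2 hsq => hm x hx (block_eq hx1 hx2) hsq

theorem mem_diagSet_iff {b : ℕ → ℕ} {D : ℕ → Set ℕ} {x : ℕ} (hsq : x ≠ x.sqrt * x.sqrt)
    (hD : x ∉ D (requirement x)) : x ∈ diagSet b D ↔ x ∈ successSet b := by
  simp only [diagSet, Set.mem_ofPred_eq, eq_false hsq, ne_eq, false_and, false_or,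
    not_false_eq_true, true_and, eq_true hD]

/-- The requirement computes the table of `C` on each of its blocks, and following it enumerates
exactly the numbers outside `C`. On a successful block, agreement survives only on squares and on `D
e`. -/
theorem lowerDensity_agreement_diagSet_lt {b : ℕ → ℕ} (hb : Computable b)
    (hrange : ¬ ComputablePred (· ∈ Set.range b)) {D : ℕ → Set ℕ} {r : ℝ} (hr : r ≤ 1)
    (hD : ∀ e, ∃ ρ, 0 ≤ ρ ∧ ρ < r ∧ D e ⊆ wedge ρ) {C : Set ℕ} (hC : ComputablePred (· ∈ C)) :
    lowerDensity (agreement (diagSet b D) C) < r := by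
  have hbound : Computable fun n : ℕ => (n + 1)! * (n + 1)! :=
    Primrec.nat_mul.to_comp.comp (computable_factorial.comp Computable.succ)
      (computable_factorial.comp Computable.succ)
  have hΦ : Computable fun n : ℕ => (List.range ((n + 1)! * (n + 1)!)).map (charFn C) :=
    computable_table (f := fun _ => charFn C) ((computable_charFn hC).comp Computable.snd) hbound
  obtain ⟨e, he⟩ := exists_requirement hb hrange hΦ.partrec
  obtain ⟨ρ, h0, hρr, hDρ⟩ := hD e
  refine lowerDensity_lt_of_frequently h0 (hρr.le.trans hr) hρr (e := e)
    ((he.resolve_left (by simp)).mono ?_)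
  rintro m ⟨l, hl, hlx⟩ x hx hblock hsq
  by_contra hw
  have hreq : requirement x = e := by simp [requirement, hblock]
  have hlt : x < (Nat.pair e m + 1)! * (Nat.pair e m + 1)! := by
    rw [← hblock]
    exact Nat.sqrt_lt.1 (lt_factorial_blockIndex_succ _)
  have hA := (mem_diagSet_iff (b := b) (D := D) hsq (hreq ▸ fun h => hw (hDρ h))).trans
    (hlx x hblock)
  rw [(Part.mem_some_iff.1 hl : l = _)] at hA
  have hx' : x ∈ diagSet b D ↔ x ∈ C := hx
  rw [List.getElem?_map, List.getElem?_range hlt, Option.map_some, Option.some_inj, hx'] at hA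
  by_cases hxC : x ∈ C
  · exact absurd (hA.1 hxC) (by simp [charFn_of_mem hxC])
  · exact hxC (hA.2 (charFn_of_notMem hxC))

/-- On block `n` the requirement searches for one nonsquare off `D e` where `ψ` converges, and lets
`A` contradict that value. Since `ψ` is never wrong, no success can occur, so the search fails on
infinitely many blocks. There `ψ.Dom` lies within `D e` and the squares. -/
theorem lowerDensity_dom_lt {b : ℕ → ℕ} (hb : Computable b)
    (hrange : ¬ ComputablePred (· ∈ Set.range b)) {D : ℕ → Set ℕ}
    (hDc : ComputablePred fun p : ℕ × ℕ => p.2 ∈ D p.1) {r : ℝ} (hr : r ≤ 1)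
    (hD : ∀ e, ∃ ρ, 0 ≤ ρ ∧ ρ < r ∧ D e ⊆ wedge ρ) {ψ : ℕ →. ℕ} (hψ : Partrec ψ)
    (hψA : ∀ n, ∀ v ∈ ψ n, v = charFn (diagSet b D) n) : lowerDensity ψ.Dom < r := by
  classical
  obtain ⟨c, rfl⟩ := Code.exists_code.1 (Partrec.nat_iff.1 hψ)
  -- The index of the requirement is read off `n`, so the search is defined without knowing `e` and
  -- no fixed point is needed.
  set target : ℕ → ℕ → Prop := fun n x =>
    block x = n ∧ x ≠ x.sqrt * x.sqrt ∧ x ∉ D n.unpair.1 with htarget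
  -- Only entry `x` matters; the filler `1` enumerates nothing.
  set table : ℕ → ℕ → List ℕ := fun x v =>
    (List.range (x + 1)).map fun i => cond (decide (i = x)) v 1 with htable
  set f : ℕ → ℕ → Option (List ℕ) := fun n t => cond (decide (target n t.unpair.1))
    ((Code.evaln t.unpair.2 c t.unpair.1).map (table t.unpair.1)) none with hf
  have htable_comp : Computable₂ table :=
    computable_table (α := ℕ × ℕ) (f := fun p i => cond (decide (i = p.1)) p.2 1)
      (Computable.cond (α := (ℕ × ℕ) × ℕ) (ComputablePred.eq Computable.snd
        (Computable.fst.comp Computable.fst)).decide (Computable.snd.comp Computable.fst)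
        (Computable.const 1)) (Computable.succ.comp Computable.fst)
  have hx : Computable fun p : ℕ × ℕ => p.2.unpair.1 :=
    Computable.fst.comp (Computable.unpair.comp Computable.snd)
  have htarget_comp : ComputablePred fun p : ℕ × ℕ => target p.1 p.2.unpair.1 :=
    (ComputablePred.eq (computable_block.comp hx) Computable.fst).and
      ((computablePred_isSquare.comp hx).not.and (hDc.comp (Computable.pair
        (Computable.fst.comp (Computable.unpair.comp Computable.fst)) hx)).not)
  have hf_comp : Computable₂ f := by
    refine Computable.cond (α := ℕ × ℕ) htarget_comp.decide (Computable.option_map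
      (Code.primrec_evaln.to_comp.comp (((Computable.snd.comp (Computable.unpair.comp
        Computable.snd)).pair (Computable.const c)).pair hx)) ?_) (Computable.const none)
    exact htable_comp.comp (α := (ℕ × ℕ) × ℕ) (hx.comp Computable.fst) Computable.snd
  obtain ⟨e, he⟩ := exists_requirement hb hrange (Partrec.rfindOpt hf_comp)
  obtain ⟨ρ, h0, hρr, hDρ⟩ := hD e
  rcases he with he | he
  · refine lowerDensity_lt_of_frequently h0 (hρr.le.trans hr) hρr (e := e) (he.mono ?_)
    intro m hm x hx hblock hsq
    by_contra hw
    refine hm (Nat.rfindOpt_dom.2 ?_)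
    obtain ⟨v, hv⟩ := Part.dom_iff_mem.1 (hx : (c.eval x).Dom)
    obtain ⟨k, hk⟩ := Code.evaln_complete.1 hv
    have ht : target (Nat.pair e m) x := ⟨hblock, hsq, by simpa using fun h => hw (hDρ h)⟩
    refine ⟨Nat.pair x k, table x v, ?_⟩
    have hk' : Code.evaln k c x = some v := hk
    simp [hf, ht, hk']
  · exfalso
    obtain ⟨m, l, hl, hlx⟩ := he.exists
    obtain ⟨t, ht⟩ := Nat.rfindOpt_spec hl
    by_cases hxt : target (Nat.pair e m) t.unpair.1
    · simp only [hf, hxt, decide_true, cond_true, Option.mem_def, Option.map_eq_some_iff] at ht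
      obtain ⟨v, hv, rfl⟩ := ht
      obtain ⟨hblock, hsq, hxD⟩ := hxt
      set x := t.unpair.1
      have hvA := hψA x v (Code.evaln_sound hv)
      have hreq : requirement x = e := by simp [requirement, hblock]
      have hA := (mem_diagSet_iff (b := b) (D := D) hsq
        (by simpa [hreq] using hxD)).trans (hlx x hblock)
      have hlist : (table x v)[x]? = some v := by simp [htable]
      rw [hlist, Option.some_inj] at hA
      by_cases hxA : x ∈ diagSet b D
      · rw [charFn_of_mem hxA] at hvA
        exact absurd (hA.1 hxA) (by omega)
      · exact hxA (hA.2 (hvA.trans (charFn_of_notMem hxA)))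
    · simp [hf, hxt] at ht

/-! ### Lower bounds and the theorem. -/

theorem partiallyComputableAt_of_inter {A D : Set ℕ} (hD : ComputablePred (· ∈ D))
    (hAD : ComputablePred (· ∈ A ∩ D)) : PartiallyComputableAt A (lowerDensity D) := by
  classical
  refine ⟨fun x => cond (decide (x ∈ D)) (Part.some (charFn (A ∩ D) x)) Part.none,
    Partrec.cond hD.decide (computable_charFn hAD).partrec Partrec.none, fun n v hv => ?_,
    lowerDensity_mono fun x hx => ?_⟩
  · by_cases h : n ∈ D
    · by_cases hA : n ∈ A <;> simp_all [charFn]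
    · simp [h] at hv
  · change (cond (decide (x ∈ D)) (Part.some (charFn (A ∩ D) x)) Part.none).Dom
    simp [hx]

theorem coarselyComputableAt_of_inter {A D : Set ℕ} (hAD : ComputablePred (· ∈ A ∩ D)) :
    CoarselyComputableAt A (lowerDensity D) :=
  ⟨A ∩ D, hAD, lowerDensity_mono fun x hx => by simp [agreement, hx]⟩

end CoarseComp

open CoarseComp in
theorem theorem3p6 (a : TuringDegree) (ha : CoarseComp.IsCEDegree a)
    (ha0 : a ≠ CoarseComp.zeroDegree) (r : ℝ) (hr : CoarseComp.IsComputableReal r)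
    (hr0 : 0 < r) (hr1 : r ≤ 1) :
    ∃ A : Set ℕ, REPred (fun n => n ∈ A) ∧ CoarseComp.degree A = a ∧
      CoarseComp.partialBound A = r ∧ CoarseComp.coarseBound A = r ∧
      ¬ CoarseComp.CoarselyComputableAt A r := by
  obtain ⟨B, hB, rfl⟩ := ha
  have hBnc : ¬ ComputablePred (· ∈ B) := fun h => ha0 (degree_eq_zeroDegree h)
  have hBne : B.Nonempty := by
    rw [Set.nonempty_iff_ne_empty]
    rintro rfl
    exact ha0 rfl
  obtain ⟨b, hb, rfl⟩ := exists_computable_range_eq hB hBne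
  obtain ⟨c, hcr, hcl, hcw⟩ := hr.exists_wedges
  -- The `c k` need not increase; finite unions make `D` monotone.
  set D : ℕ → Set ℕ := fun e => {x | ∃ k < e + 1, x ∈ wedge (c k)}
  have hDc : ComputablePred fun p : ℕ × ℕ => p.2 ∈ D p.1 :=
    ComputablePred.exists_lt (R := fun (p : ℕ × ℕ) k => p.2 ∈ wedge (c k))
      (hcw.comp (Computable.snd.pair (Computable.snd.comp Computable.fst)))
      (Computable.succ.comp Computable.fst)
  have hmono : Monotone D := fun d e hde x ⟨k, hk, hx⟩ => ⟨k, by omega, hx⟩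
  have hsq : ∀ e, ∀ x ∈ D e, x ≠ x.sqrt * x.sqrt :=
    fun e x ⟨k, _, hx⟩ => ne_square_of_mem_wedge hx
  have hD : ∀ e, ∃ ρ, 0 ≤ ρ ∧ ρ < r ∧ D e ⊆ wedge ρ := by
    intro e
    -- The maximum starts from `0`, as the `c k` may be negative; this uses `0 < r`.
    obtain ⟨ρ, h0, hρr, hρ⟩ : ∃ ρ, 0 ≤ ρ ∧ ρ < r ∧ ∀ k < e + 1, c k ≤ ρ := by
      induction e + 1 with
      | zero => exact ⟨0, le_rfl, hr0, by simp⟩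
      | succ n ih =>
        obtain ⟨ρ, h0, hρr, hρ⟩ := ih
        refine ⟨max ρ (c n), h0.trans (le_max_left _ _), max_lt hρr (hcr n), fun k hk => ?_⟩
        rcases Nat.lt_succ_iff_lt_or_eq.1 hk with h | rfl
        · exact (hρ k h).trans (le_max_left _ _)
        · exact le_max_right _ _
    exact ⟨ρ, h0, hρr, fun x ⟨k, hk, hx⟩ => wedge_mono (hρ k hk) hx⟩
  have hpartial : ∀ t, PartiallyComputableAt (diagSet b D) t → t < r := by
    rintro t ⟨φ, hφ, hφA, ht⟩
    exact ht.trans_lt (lowerDensity_dom_lt hb hBnc hDc hr1 hD hφ hφA)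
  have hcoarse : ∀ t, CoarselyComputableAt (diagSet b D) t → t < r := by
    rintro t ⟨C, hC, ht⟩
    exact ht.trans_lt (lowerDensity_agreement_diagSet_lt hb hBnc hr1 hD hC)
  have hlower : ∀ w < r, ∃ t ∈ Set.Icc (0 : ℝ) 1, w < t ∧
      PartiallyComputableAt (diagSet b D) t ∧ CoarselyComputableAt (diagSet b D) t := by
    intro w hw
    -- Exceeding `0` as well as `w` puts `c k` into `[0, 1]`.
    obtain ⟨k, hk⟩ := hcl (max w 0) (max_lt hw hr0)
    have hk0 : 0 ≤ c k := (le_max_right w 0).trans hk.le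
    have hk1 : c k ≤ 1 := (hcr k).le.trans hr1
    have hDk : ComputablePred (· ∈ D k) :=
      hDc.comp (Computable.pair (Computable.const k) Computable.id)
    have hADk := computablePred_diagSet_inter hb hDc hmono hsq k
    have hdens : c k ≤ lowerDensity (D k) := (le_lowerDensity_wedge hk0 hk1).trans
      (lowerDensity_mono fun x hx => ⟨k, k.lt_succ_self, hx⟩)
    obtain ⟨φ, hφ, hφA, h1⟩ := partiallyComputableAt_of_inter hDk hADk
    obtain ⟨C, hC, h2⟩ := coarselyComputableAt_of_inter hADk
    exact ⟨c k, ⟨hk0, hk1⟩, (le_max_left w 0).trans_lt hk, ⟨φ, hφ, hφA, hdens.trans h1⟩,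
      ⟨C, hC, hdens.trans h2⟩⟩
  obtain ⟨hre, hred⟩ := diagSet_reducible hb hDc
  obtain ⟨t₀, ht₀, -, hp₀, hc₀⟩ := hlower 0 hr0
  refine ⟨diagSet b D, hre, degree_eq_of_turingReducible hred (range_reducible_diagSet b D),
    ?_, ?_, fun h => (hcoarse r h).false⟩
  · refine csSup_eq_of_forall_le_of_forall_lt_exists_gt ⟨t₀, ht₀, hp₀⟩
      (fun t ht => (hpartial t ht.2).le) fun w hw => ?_
    obtain ⟨t, ht, hwt, hp, -⟩ := hlower w hw
    exact ⟨t, ⟨ht, hp⟩, hwt⟩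
  · refine csSup_eq_of_forall_le_of_forall_lt_exists_gt ⟨t₀, ht₀, hc₀⟩
      (fun t ht => (hcoarse t ht.2).le) fun w hw => ?_
    obtain ⟨t, ht, hwt, -, hc⟩ := hlower w hw
    exact ⟨t, ⟨ht, hc⟩, hwt⟩
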